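/- Let $A$ be a C*-algebra (not necessarily unital), with positive cone $A_+$. A subset $\mathcal F\subseteq A_+$ is a *filling family* for $A$ if for all $a,b,c\in A$ with $0\le a\le b\le c\le 1$, $ab=a\neq 0$ and $bc=b$ there exist finitely many $z_1,\dots,z_n\in A$ and $d\in A$ with $z_jz_j^*\in\mathcal F$ for all $j$ such that $e:=z_1^*z_1+\dots+z_n^*z_n$ satisfies $ec=e$ and $d^*ed=a$. (If $A$ has no unit, $c\le 1$ is understood in the unitization of $A$.) An $n$-tuple $(a_1,\dots,a_n)$ of elements of $A_+$ has the *matrix diagonalization property* in $A$ if for every positive matrix $[a_{ij}]\in M_n(A)_+$ with $a_{jj}=a_j$ for all $j$, and all $\varepsilon_1,\dots,\varepsilon_n>0$ and $\tau>0$, there are $s_1,\dots,s_n\in A$ with $\|s_j^*a_{jj}s_j-a_{jj}\|<\varepsilon_j$ for all $j$ and $\|s_i^*a_{ij}s_j\|<\tau$ for all $i\ne j$. A subset $\mathcal F\subseteq A_+$ has the *matrix diagonalization property* in $A$ if every finite sequence $a_1,\dots,a_n\in\mathcal F$ has it. $A$ is *strongly purely infinite* if for all $a,b\in A_+$ and $\varepsilon>0$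 there are $s,t\in A$ with $\|s^*a^2s-a^2\|<\varepsilon$, $\|t^*b^2t-b^2\|<\varepsilon$ and $\|s^*abt\|<\varepsilon$. **Theorem.** Suppose that $A_+$ contains a filling family $\mathcal F$ for $A$ that has the matrix diagonalization property in $A$. Then $A$ is strongly purely infinite; moreover, every pair $(a,b)$ of elements of $A_+$ has the matrix diagonalization property in $A$. -/

import Mathlib

/-- A C⋆-algebra `A` (unital or not) is *strongly purely infinite* if for all `a, b ∈ A₊` and all
`ε > 0` there are `s, t ∈ A` with `‖s⋆ a² s - a²‖ < ε`, `‖t⋆ b² t - b²‖ < ε` and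
`‖s⋆ a b t‖ < ε`. -/
def IsStronglyPurelyInfinite (A : Type*) [NonUnitalCStarAlgebra A] [PartialOrder A]
    [StarOrderedRing A] : Prop :=
  ∀ a b : A, 0 ≤ a → 0 ≤ b → ∀ ε : ℝ, 0 < ε →
    ∃ s t : A,
      ‖star s * (a * a) * s - a * a‖ < ε ∧
      ‖star t * (b * b) * t - b * b‖ < ε ∧
      ‖star s * (a * b) * t‖ < ε

/-- A set `F` of positive elements of a C⋆-algebra `A` is a *filling family* for `A` if for all
`a, b, c ∈ A` with `0 ≤ a ≤ b ≤ c ≤ 1`, `a b = a ≠ 0` and `b c = b` there are `z₁, …, zₙ, d ∈ A`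
with `zⱼ zⱼ⋆ ∈ F` such that `e := z₁⋆ z₁ + ⋯ + zₙ⋆ zₙ` satisfies `e c = e` and `d⋆ e d = a`.
As `A` need not have a unit, `c ≤ 1` (in the unitization, for the positive element `c`) is
written in the equivalent form `‖c‖ ≤ 1`. -/
def IsFillingFamily {A : Type*} [NonUnitalCStarAlgebra A] [PartialOrder A]
    [StarOrderedRing A] (F : Set A) : Prop :=
  (∀ f ∈ F, 0 ≤ f) ∧
  ∀ a b c : A, 0 ≤ a → a ≤ b → b ≤ c → ‖c‖ ≤ 1 → a * b = a → a ≠ 0 → b * c = b →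
    ∃ (n : ℕ) (z : Fin n → A) (d : A),
      (∀ j, z j * star (z j) ∈ F) ∧
      (∑ j, star (z j) * z j) * c = ∑ j, star (z j) * z j ∧
      star d * (∑ j, star (z j) * z j) * d = a

/-- An `n`-tuple `a` of positive elements of `A` has the *matrix diagonalization property* (in
`A`) if for every positive matrix `M` in the C⋆-algebra `Mₙ(A)` with diagonal entries
`M j j = a j`, and all `εⱼ > 0`, `τ > 0`, there are `s₁, …, sₙ ∈ A` with
`‖sⱼ⋆ (M j j) sⱼ - M j j‖ < εⱼ` for all `j` and `‖sᵢ⋆ (M i j) sⱼ‖ < τ` for all `i ≠ j`. -/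
def HasMatrixDiagonalization {A : Type*} [NonUnitalCStarAlgebra A] [PartialOrder A]
    [StarOrderedRing A] {n : ℕ} (a : Fin n → A) : Prop :=
  ∀ M : CStarMatrix (Fin n) (Fin n) A, 0 ≤ M → (∀ j, M j j = a j) →
    ∀ (ε : Fin n → ℝ) (τ : ℝ), (∀ j, 0 < ε j) → 0 < τ →
      ∃ s : Fin n → A,
        (∀ j, ‖star (s j) * M j j * s j - M j j‖ < ε j) ∧
        ∀ i j, i ≠ j → ‖star (s i) * M i j * s j‖ < τ

/-- A family `F` of positive elements has the *matrix diagonalization property* (in `A`) if every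
finite sequence in `F` (repetitions allowed) has it. -/
def HasMatrixDiagonalizationFamily {A : Type*} [NonUnitalCStarAlgebra A] [PartialOrder A]
    [StarOrderedRing A] (F : Set A) : Prop :=
  ∀ (n : ℕ) (a : Fin n → A), (∀ j, a j ∈ F) → HasMatrixDiagonalization a

/-! Every positive `a` is approximately `∑ wᵢ⋆ (yᵢ⋆ a yᵢ) wᵢ` with `yᵢ⋆ a yᵢ ∈ F`
(`IsFillingFamily.exists_norm_sum_sub_lt`): the filling property is applied to three nested cut-offs
of `a`, and a truncated inverse square root of `a` turns the resulting `zⱼ zⱼ⋆` into compressions of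
`a`. Given a positive matrix `M`, compress it by the `y`'s of all its diagonal entries at once. The
larger matrix is positive with diagonal in `F`, so it can be almost diagonalized, which makes the
cross terms small both between different blocks and inside each block. The elements `∑ᵢ yⱼᵢ sⱼᵢ wⱼᵢ`
then almost diagonalize `M` itself (`IsFillingFamily.hasMatrixDiagonalization`). -/

/-! ### Scalar functions for the functional calculus. -/

/-- The function `√t / max t δ`, whose square is `t⁻¹` on `[δ, ∞)`. -/
noncomputable def truncInvSqrt (δ t : ℝ) : ℝ := √t / max t δ

theorem continuous_truncInvSqrt {δ : ℝ} (hδ : 0 < δ) : Continuous (truncInvSqrt δ) := by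
  unfold truncInvSqrt
  exact Real.continuous_sqrt.div (by fun_prop) fun t ↦ (lt_max_of_lt_right hδ).ne'

theorem truncInvSqrt_zero (δ : ℝ) : truncInvSqrt δ 0 = 0 := by simp [truncInvSqrt]

theorem truncInvSqrt_mul_mul_eq_one {δ t : ℝ} (hδ : 0 < δ) (ht : δ ≤ t) :
    truncInvSqrt δ t * t * truncInvSqrt δ t = 1 := by
  have h0 : 0 < t := hδ.trans_le ht
  rw [truncInvSqrt, max_eq_left ht]
  field_simp
  rw [Real.sq_sqrt h0.le]

theorem abs_truncInvSqrt_mul_mul_sub_one_le {δ t : ℝ} (hδ : 0 < δ) (ht : 0 ≤ t) :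
    |truncInvSqrt δ t * t * truncInvSqrt δ t - 1| ≤ 1 := by
  have hm : 0 < max t δ := lt_max_of_lt_right hδ
  have h : truncInvSqrt δ t * t * truncInvSqrt δ t = (t / max t δ) ^ 2 := by
    rw [truncInvSqrt]
    field_simp
    rw [Real.sq_sqrt ht]
    ring
  have h1 : t / max t δ ≤ 1 := (div_le_one hm).2 (le_max_left _ _)
  have h2 : 0 ≤ t / max t δ := by positivity
  rw [h, abs_le]
  constructor <;> nlinarith

/-- The piecewise linear function that vanishes on `(-∞, r * δ]` and equals `1` on
`[(r + 1) * δ, ∞)`. -/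
noncomputable def ramp (δ r t : ℝ) : ℝ := max 0 (min 1 (t / δ - r))

theorem continuous_ramp (δ r : ℝ) : Continuous (ramp δ r) := by
  unfold ramp
  fun_prop

theorem ramp_zero {δ r : ℝ} (hr : 0 ≤ r) : ramp δ r 0 = 0 := by
  simp [ramp, hr]

theorem ramp_nonneg (δ r t : ℝ) : 0 ≤ ramp δ r t := le_max_left _ _

theorem ramp_le_one (δ r t : ℝ) : ramp δ r t ≤ 1 := max_le zero_le_one (min_le_left _ _)

theorem ramp_eq_one {δ r t : ℝ} (hδ : 0 < δ) (ht : (r + 1) * δ ≤ t) : ramp δ r t = 1 := by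
  have : r + 1 ≤ t / δ := (le_div_iff₀ hδ).2 ht
  rw [ramp, min_eq_left (by linarith), max_eq_right zero_le_one]

theorem ramp_eq_zero {δ r t : ℝ} (hδ : 0 < δ) (ht : t ≤ r * δ) : ramp δ r t = 0 := by
  have : t / δ ≤ r := (div_le_iff₀ hδ).2 ht
  rw [ramp, max_eq_left]
  exact (min_le_right _ _).trans (by linarith)

theorem ramp_mul_ramp {δ : ℝ} (hδ : 0 < δ) (r t : ℝ) :
    ramp δ (r + 1) t * ramp δ r t = ramp δ (r + 1) t := by
  rcases le_total t ((r + 1) * δ) with h | h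
  · rw [ramp_eq_zero hδ h, zero_mul]
  · rw [ramp_eq_one hδ h, mul_one]

theorem ramp_anti (δ t : ℝ) {r r' : ℝ} (h : r ≤ r') : ramp δ r' t ≤ ramp δ r t :=
  max_le_max le_rfl (min_le_min le_rfl (by linarith))

theorem abs_mul_ramp_sub_le {δ r t : ℝ} (hδ : 0 < δ) (hr : 0 ≤ r) (ht : 0 ≤ t) :
    |t * ramp δ r t - t| ≤ (r + 1) * δ := by
  rcases le_total t ((r + 1) * δ) with h | h
  · have h0 := ramp_nonneg δ r t
    have h1 := ramp_le_one δ r t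
    rw [abs_le]
    constructor <;> nlinarith
  · rw [ramp_eq_one hδ h, mul_one, sub_self, abs_zero]
    positivity

theorem CStarMatrix.ofMatrix_entry {m n R : Type*} (f : m → n → R) (i : m) (j : n) :
    (CStarMatrix.ofMatrix f : CStarMatrix m n R) i j = f i j := rfl

section CStar

variable {A : Type*} [NonUnitalCStarAlgebra A] [PartialOrder A] [StarOrderedRing A]

/-! ### Approximating positive elements through a filling family. -/

/-- Every `z⋆ z` is approximately of the form `w⋆ (z z⋆) w`. -/
theorem exists_norm_star_mul_mul_star_mul_sub_lt (z : A) {ε : ℝ} (hε : 0 < ε) :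
    ∃ w : A, ‖star w * (z * star z) * w - star z * z‖ < ε := by
  set p := z * star z with hp
  have hp0 : 0 ≤ p := mul_star_self_nonneg z
  set κ : ℝ := ε / (‖z‖ + 1) with hκ
  have hκ0 : 0 < κ := by positivity
  set δ : ℝ := κ ^ 2 with hδ
  have hδ0 : 0 < δ := by positivity
  have hf := continuous_truncInvSqrt hδ0
  have hf0 := truncInvSqrt_zero δ
  set f := cfcₙ (truncInvSqrt δ) p
  have hfs : star f = f := (IsSelfAdjoint.cfcₙ (f := truncInvSqrt δ) (a := p)).star_eq
  have hidp : cfcₙ (fun t : ℝ ↦ t) p = p := cfcₙ_id' ℝ p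
  set q := f * p * f with hq
  have hqs : star q = q := by
    simp only [hq, star_mul, hfs, (IsSelfAdjoint.of_nonneg hp0).star_eq, mul_assoc]
  have hqc : q = cfcₙ (fun t ↦ truncInvSqrt δ t * t * truncInvSqrt δ t) p := by
    rw [cfcₙ_mul _ _ p (by fun_prop) (by simp) (by fun_prop) hf0,
      cfcₙ_mul _ _ p (by fun_prop) hf0 (by fun_prop) rfl, hidp]
  set g : ℝ → ℝ := fun t ↦ truncInvSqrt δ t * t * truncInvSqrt δ t with hg
  have hgc : Continuous g := by fun_prop
  have hg0 : g 0 = 0 := by simp [hg]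
  -- By the C⋆-identity the squared error is a function of `p`, namely `t (g t - 1)²`, which is at
  -- most `δ = κ²`.
  have hdist : ‖q * z - z‖ ≤ κ := by
    refine le_of_sq_le_sq ?_ hκ0.le
    rw [sq, ← CStarRing.norm_self_mul_star]
    have h1 : (q * z - z) * star (q * z - z) = q * p * q - q * p - (p * q - p) := by
      simp only [star_sub, star_mul, hqs, hp]
      noncomm_ring
    have h2 : q * p * q - q * p - (p * q - p) =
        cfcₙ (fun t ↦ g t * t * g t - g t * t - (t * g t - t)) p := by
      rw [cfcₙ_sub _ _ p (by fun_prop) (by simp) (by fun_prop) (by simp),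
        cfcₙ_sub _ _ p (by fun_prop) (by simp) (by fun_prop) (by simp),
        cfcₙ_sub _ _ p (by fun_prop) (by simp) (by fun_prop) rfl,
        cfcₙ_mul (fun t ↦ g t * t) g p (by fun_prop) (by simp) (by fun_prop) hg0,
        cfcₙ_mul g (fun t ↦ t) p (by fun_prop) hg0 (by fun_prop) rfl,
        cfcₙ_mul (fun t ↦ t) g p (by fun_prop) rfl (by fun_prop) hg0,
        hidp, ← hqc]
    rw [h1, h2]
    refine norm_cfcₙ_le fun t ht ↦ ?_
    have ht0 : 0 ≤ t := quasispectrum_nonneg_of_nonneg p hp0 t ht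
    have h3 : g t * t * g t - g t * t - (t * g t - t) = t * (g t - 1) ^ 2 := by ring
    rw [h3, Real.norm_of_nonneg (by positivity)]
    rcases le_total δ t with h | h
    · have : g t = 1 := truncInvSqrt_mul_mul_eq_one hδ0 h
      rw [this]
      rw [sub_self, zero_pow two_ne_zero, mul_zero]
      exact hδ0.le
    · have h4 : (g t - 1) ^ 2 ≤ 1 :=
        (sq_le_one_iff_abs_le_one _).2 (abs_truncInvSqrt_mul_mul_sub_one_le hδ0 ht0)
      nlinarith
  refine ⟨f * z, ?_⟩
  have h5 : star (f * z) * p * (f * z) - star z * z = star z * (q * z - z) := by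
    simp only [star_mul, hfs, hq]
    noncomm_ring
  rw [h5]
  calc ‖star z * (q * z - z)‖ ≤ ‖star z‖ * ‖q * z - z‖ := norm_mul_le _ _
    _ ≤ ‖z‖ * κ := by rw [norm_star]; gcongr
    _ < (‖z‖ + 1) * κ := by gcongr; linarith
    _ = ε := by rw [hκ]; field_simp

/-- If `∑ zⱼ⋆ zⱼ` is fixed by right multiplication with the self-adjoint `c`, so is each `zⱼ`. -/
theorem mul_eq_self_of_sum_star_mul_self_mul_eq {ι : Type*} [Fintype ι] {z : ι → A} {c : A}
    (hc : IsSelfAdjoint c)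
    (h : (∑ j, star (z j) * z j) * c = ∑ j, star (z j) * z j) (j : ι) : z j * c = z j := by
  -- With `e = ∑ zᵢ⋆ zᵢ`, this sum is `c (e c - e) - (e c - e)`.
  have hsum : ∑ i, star (z i * c - z i) * (z i * c - z i) = 0 := by
    have h1 : ∀ i, star (z i * c - z i) * (z i * c - z i) =
        c * (star (z i) * z i * c - star (z i) * z i) -
          (star (z i) * z i * c - star (z i) * z i) := by
      intro i
      simp only [star_sub, star_mul, hc.star_eq]
      noncomm_ring
    simp only [h1, Finset.sum_sub_distrib, ← Finset.mul_sum, ← Finset.sum_mul, h, sub_self,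
      mul_zero]
  have h2 := (Finset.sum_eq_zero_iff_of_nonneg fun i _ ↦ star_mul_self_nonneg _).1 hsum j
    (Finset.mem_univ j)
  exact sub_eq_zero.1 ((CStarRing.star_mul_self_eq_zero_iff _).1 h2)

/-- If a filling family is given, then every positive `a` is approximately of the form
`∑ wᵢ⋆ (yᵢ⋆ a yᵢ) wᵢ` with all `yᵢ⋆ a yᵢ` in the family. -/
theorem IsFillingFamily.exists_norm_sum_sub_lt {F : Set A} (hF : IsFillingFamily F) {a : A}
    (ha : 0 ≤ a) {ε : ℝ} (hε : 0 < ε) :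
    ∃ (m : ℕ) (y w : Fin m → A), (∀ i, star (y i) * a * y i ∈ F) ∧
      ‖∑ i, star (w i) * (star (y i) * a * y i) * w i - a‖ < ε := by
  set δ : ℝ := ε / 8 with hδ
  have hδ0 : 0 < δ := by positivity
  have hcont := continuous_ramp δ
  have hida : cfcₙ (fun t : ℝ ↦ t) a = a := cfcₙ_id' ℝ a
  have hram {r : ℝ} (hr : 0 ≤ r) : ramp δ r 0 = 0 := ramp_zero hr
  -- `u 3 ≤ u 2 ≤ u 1` will be the filling triple. The shifts start at `1` because `truncInvSqrt δ`
  -- inverts exactly only on `[δ, ∞)`, and `ramp δ 1` vanishes below `δ`.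
  set u : ℝ → A := fun r ↦ cfcₙ (ramp δ r) a with hu
  have hmul {r : ℝ} (hr : 0 ≤ r) : u (r + 1) * u r = u (r + 1) := by
    simp only [hu]
    rw [← cfcₙ_mul _ _ a (by fun_prop) (hram (by positivity)) (by fun_prop) (hram hr)]
    exact cfcₙ_congr fun t _ ↦ ramp_mul_ramp hδ0 r t
  have hle {r : ℝ} (hr : 0 ≤ r) : u (r + 1) ≤ u r :=
    cfcₙ_mono (fun t _ ↦ ramp_anti δ t (by linarith)) (by fun_prop) (by fun_prop)
      (hram (by positivity)) (hram hr)
  have hnn (r : ℝ) : 0 ≤ u r := cfcₙ_nonneg fun t _ ↦ ramp_nonneg δ r t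
  have hn1 : ‖u 1‖ ≤ 1 := norm_cfcₙ_le fun t _ ↦ by
    rw [Real.norm_of_nonneg (ramp_nonneg _ _ _)]
    exact ramp_le_one _ _ _
  set s := cfcₙ Real.sqrt a with hs
  have hss : star s = s := (IsSelfAdjoint.cfcₙ (f := Real.sqrt) (a := a)).star_eq
  have hsus : ‖s * u 3 * s - a‖ < ε / 2 + ε / 4 := by
    have h1 : s * u 3 * s - a = cfcₙ (fun t ↦ √t * ramp δ 3 t * √t - t) a := by
      rw [cfcₙ_sub _ _ a (by fun_prop) (by simp) (by fun_prop) rfl,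
        cfcₙ_mul _ _ a (by fun_prop) (by simp) (by fun_prop) (by simp),
        cfcₙ_mul _ _ a (by fun_prop) (by simp) (by fun_prop) (hram (by norm_num)), hida]
    rw [h1]
    refine lt_of_le_of_lt (norm_cfcₙ_le (c := (3 + 1) * δ) fun t ht ↦ ?_) (by linarith)
    have ht0 : 0 ≤ t := quasispectrum_nonneg_of_nonneg a ha t ht
    have h2 : √t * ramp δ 3 t * √t = t * ramp δ 3 t := by
      rw [mul_right_comm, Real.mul_self_sqrt ht0]
    rw [h2]
    exact abs_mul_ramp_sub_le hδ0 (by norm_num) ht0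
  have h21 : u 2 * u 1 = u 2 := by
    have := hmul (r := 1) (by norm_num)
    norm_num at this
    exact this
  have h32 : u 3 * u 2 = u 3 := by
    have := hmul (r := 2) (by norm_num)
    norm_num at this
    exact this
  have hle21 : u 2 ≤ u 1 := by
    have := hle (r := 1) (by norm_num)
    norm_num at this
    exact this
  have hle32 : u 3 ≤ u 2 := by
    have := hle (r := 2) (by norm_num)
    norm_num at this
    exact this
  obtain ⟨n, z, d, hzF, hzc, hd⟩ : ∃ (n : ℕ) (z : Fin n → A) (d : A),
      (∀ j, z j * star (z j) ∈ F) ∧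
      (∑ j, star (z j) * z j) * u 1 = ∑ j, star (z j) * z j ∧
      star d * (∑ j, star (z j) * z j) * d = u 3 := by
    -- The filling property needs a nonzero element; for `u 3 = 0` the empty family works.
    by_cases h0 : u 3 = 0
    · exact ⟨0, fun i ↦ i.elim0, 0, fun i ↦ i.elim0, by simp, by simp [h0]⟩
    · exact hF.2 _ _ _ (hnn 3) hle32 hle21 hn1 h32 h0 h21
  have hzu := mul_eq_self_of_sum_star_mul_self_mul_eq (IsSelfAdjoint.of_nonneg (hnn 1)) hzc
  have hf := continuous_truncInvSqrt hδ0
  have hf0 := truncInvSqrt_zero δ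
  set f := cfcₙ (truncInvSqrt δ) a
  have hfs : star f = f := (IsSelfAdjoint.cfcₙ (f := truncInvSqrt δ) (a := a)).star_eq
  -- `f a f` acts as a unit on `u 1`, hence on every `zⱼ = zⱼ (u 1)`.
  have hufaf : u 1 * (f * a * f) = u 1 := by
    have h1 : u 1 * (f * a * f) =
        cfcₙ (fun t ↦ ramp δ 1 t * (truncInvSqrt δ t * t * truncInvSqrt δ t)) a := by
      rw [cfcₙ_mul _ _ a (by fun_prop) (hram (by norm_num)) (by fun_prop) (by simp),
        cfcₙ_mul _ _ a (by fun_prop) (by simp) (by fun_prop) hf0,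
        cfcₙ_mul _ _ a (by fun_prop) hf0 (by fun_prop) rfl, hida]
    rw [h1]
    refine cfcₙ_congr fun t _ ↦ ?_
    rcases le_total δ t with h | h
    · simp only [truncInvSqrt_mul_mul_eq_one hδ0 h, mul_one]
    · have h2 : ramp δ 1 t = 0 := ramp_eq_zero hδ0 (by rwa [one_mul])
      simp only [h2, zero_mul]
  have hzfaf (j) : z j * (f * a * f) = z j := by
    rw [← hzu j, mul_assoc, hufaf]
  have hy (j) : star (f * star (z j)) * a * (f * star (z j)) = z j * star (z j) := by
    calc star (f * star (z j)) * a * (f * star (z j)) = z j * (f * a * f) * star (z j) := by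
          simp only [star_mul, star_star, hfs, mul_assoc]
      _ = z j * star (z j) := by rw [hzfaf]
  set D := d * s with hD
  set κ : ℝ := ε / 4 / ((n + 1) * (‖D‖ ^ 2 + 1)) with hκ
  have hκ0 : 0 < κ := by positivity
  choose v hv using fun j ↦ exists_norm_star_mul_mul_star_mul_sub_lt (z j) hκ0
  refine ⟨n, fun j ↦ f * star (z j), fun j ↦ v j * D, fun j ↦ by rw [hy]; exact hzF j, ?_⟩
  have hsplit : ∑ j, star (v j * D) * (star (f * star (z j)) * a * (f * star (z j))) * (v j * D)
      - a = star D * (∑ j, (star (v j) * (z j * star (z j)) * v j - star (z j) * z j)) * D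
        + (s * u 3 * s - a) := by
    simp only [hy]
    rw [← hd, Finset.sum_sub_distrib, mul_sub, sub_mul, hD, Finset.mul_sum, Finset.sum_mul]
    simp only [star_mul, hss, mul_assoc]
    abel
  rw [hsplit]
  have hb : ‖star D * (∑ j, (star (v j) * (z j * star (z j)) * v j - star (z j) * z j)) * D‖
      ≤ ε / 4 := by
    calc _ ≤ ‖D‖ * ‖∑ j, (star (v j) * (z j * star (z j)) * v j - star (z j) * z j)‖ * ‖D‖ := by
          refine (norm_mul_le _ _).trans ?_
          gcongr
          refine (norm_mul_le _ _).trans ?_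
          rw [norm_star]
      _ ≤ ‖D‖ * (n * κ) * ‖D‖ := by
          gcongr
          refine (norm_sum_le_of_le _ fun j _ ↦ (hv j).le).trans ?_
          simp
      _ = n * ‖D‖ ^ 2 * κ := by ring
      _ ≤ ((n + 1) * (‖D‖ ^ 2 + 1)) * κ := by
          gcongr <;> linarith
      _ = ε / 4 := by rw [hκ]; field_simp
  linarith [norm_add_le
    (star D * (∑ j, (star (v j) * (z j * star (z j)) * v j - star (z j) * z j)) * D)
    (s * u 3 * s - a)]

/-- Positive elements have square roots. -/
theorem exists_eq_star_mul_self {a : A} (ha : 0 ≤ a) : ∃ y : A, a = star y * y :=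
  CStarAlgebra.nonneg_iff_eq_star_mul_self.1 ha

/-! ### Positivity of Gram matrices and compressions. -/

namespace CStarMatrix

/-- The Gram matrix `(xᵢ⋆ xⱼ)` of a family in `A` is positive. -/
theorem nonneg_ofMatrix_star_mul {n : Type*} [Fintype n] (x : n → A) :
    0 ≤ (ofMatrix (fun i j ↦ star (x i) * x j) : CStarMatrix n n A) := by
  classical
  rcases isEmpty_or_nonempty n with h | ⟨⟨i₀⟩⟩
  · exact le_of_eq (ext fun i ↦ isEmptyElim i)
  -- `Q` carries `x` in the single row `i₀` and is zero elsewhere.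
  · set Q : CStarMatrix n n A := ofMatrix (fun i j ↦ if i = i₀ then x j else 0) with hQ
    have : (ofMatrix (fun i j ↦ star (x i) * x j) : CStarMatrix n n A) = star Q * Q := by
      ext i j
      rw [mul_apply, Finset.sum_eq_single i₀]
      · simp [star_apply, hQ, ofMatrix_entry]
      · intro b _ hb
        simp [hQ, hb, ofMatrix_entry]
      · simp
    rw [this]
    exact star_mul_self_nonneg Q

/-- Compressions of positive matrices, possibly with repeated rows, are positive. -/
theorem nonneg_ofMatrix_star_mul_mul {m n : Type*} [Fintype m] [Fintype n]
    {M : CStarMatrix m m A} (hM : 0 ≤ M) (k : n → m) (v : n → A) :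
    0 ≤ (ofMatrix (fun i j ↦ star (v i) * M (k i) (k j) * v j) : CStarMatrix n n A) := by
  classical
  obtain ⟨Y, rfl⟩ := exists_eq_star_mul_self hM
  -- Each row of `Y`, compressed by `v`, contributes one Gram matrix.
  have : (ofMatrix (fun i j ↦ star (v i) * (star Y * Y) (k i) (k j) * v j) :
      CStarMatrix n n A) = ∑ l, ofMatrix (fun i j ↦ star (Y l (k i) * v i) * (Y l (k j) * v j)) := by
    ext i j
    have happ (s : Finset m) (N : m → CStarMatrix n n A) :
        (∑ l ∈ s, N l) i j = ∑ l ∈ s, N l i j := by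
      induction s using Finset.induction_on with
      | empty => simp
      | insert a s ha ih => rw [Finset.sum_insert ha, Finset.sum_insert ha, add_apply, ih]
    rw [happ]
    simp only [ofMatrix_entry, mul_apply, star_apply, star_mul, Finset.mul_sum, Finset.sum_mul,
      mul_assoc]
  rw [this]
  exact Finset.sum_nonneg fun l _ ↦ nonneg_ofMatrix_star_mul _

end CStarMatrix

/-! ### Transferring diagonalization from the family to all positive elements. -/

/-- The matrix diagonalization property for tuples indexed by an arbitrary finite type, in the
form of a uniform bound. -/
theorem HasMatrixDiagonalizationFamily.exists_norm_sub_lt {F : Set A}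
    (hF : HasMatrixDiagonalizationFamily F) {ι : Type*} [Fintype ι] [DecidableEq ι]
    {P : CStarMatrix ι ι A} (hP : 0 ≤ P) (hPF : ∀ i, P i i ∈ F) {t : ℝ} (ht : 0 < t) :
    ∃ s : ι → A, ∀ i j, ‖star (s i) * P i j * s j - (if i = j then P i j else 0)‖ ≤ t := by
  let e := Fintype.equivFin ι
  set M : CStarMatrix (Fin (Fintype.card ι)) (Fin (Fintype.card ι)) A :=
    CStarMatrix.ofMatrix (fun i j ↦ P (e.symm i) (e.symm j)) with hM
  have hM0 : 0 ≤ M := by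
    have := map_nonneg (CStarMatrix.reindexₐ ℂ A e) hP
    exact this
  obtain ⟨s, hs, hs'⟩ := hF _ (fun j ↦ M j j) (fun j ↦ hPF _) M hM0 (fun _ ↦ rfl) (fun _ ↦ t) t
    (fun _ ↦ ht) ht
  refine ⟨fun i ↦ s (e i), fun i j ↦ ?_⟩
  by_cases h : i = j
  · subst h
    have := (hs (e i)).le
    simpa [hM, CStarMatrix.ofMatrix_entry] using this
  · have := (hs' (e i) (e j) (by simpa using h)).le
    simpa [hM, h, CStarMatrix.ofMatrix_entry] using this

/-- A filling family with the matrix diagonalization property forces the matrix diagonalization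
property for all finite tuples of positive elements. -/
theorem IsFillingFamily.hasMatrixDiagonalization {F : Set A} (hfill : IsFillingFamily F)
    (hdiag : HasMatrixDiagonalizationFamily F) {n : ℕ} {a : Fin n → A} (ha : ∀ j, 0 ≤ a j) :
    HasMatrixDiagonalization a := by
  intro M hM hMa ε τ hε hτ
  choose m y w hyF hw using fun j ↦ hfill.exists_norm_sum_sub_lt (ha j) (half_pos (hε j))
  set P : CStarMatrix (Σ j, Fin (m j)) (Σ j, Fin (m j)) A :=
    CStarMatrix.ofMatrix (fun p q ↦ star (y p.1 p.2) * M p.1 q.1 * y q.1 q.2) with hP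
  have hP0 : 0 ≤ P :=
    CStarMatrix.nonneg_ofMatrix_star_mul_mul hM (fun p : Σ j, Fin (m j) ↦ p.1)
      (fun p ↦ y p.1 p.2)
  have hPF (p) : P p p ∈ F := by
    simp only [hP, CStarMatrix.ofMatrix_entry, hMa]
    exact hyF p.1 p.2
  set C : ℝ := (∑ j, ∑ i, ‖w j i‖) ^ 2 with hC
  obtain ⟨t, ht0, htτ, htε⟩ : ∃ t : ℝ, 0 < t ∧ C * t < τ ∧ ∀ j, C * t < ε j / 2 := by
    have hlim : Filter.Tendsto (fun t : ℝ ↦ C * t) (nhdsWithin 0 (Set.Ioi 0)) (nhds 0) := by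
      have : Filter.Tendsto (fun t : ℝ ↦ C * t) (nhds 0) (nhds (C * 0)) :=
        (continuous_const.mul continuous_id).tendsto 0
      rw [mul_zero] at this
      exact this.mono_left nhdsWithin_le_nhds
    have h1 := hlim.eventually (gt_mem_nhds hτ)
    have h2 := Filter.eventually_all.2 fun j ↦ hlim.eventually (gt_mem_nhds (half_pos (hε j)))
    obtain ⟨t, ht⟩ := (h1.and (h2.and self_mem_nhdsWithin)).exists
    exact ⟨t, ht.2.2, ht.1, ht.2.1⟩
  obtain ⟨s, hs⟩ := hdiag.exists_norm_sub_lt hP0 hPF ht0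
  have hbound (j l : Fin n) : ‖∑ i, ∑ i', star (w j i) * (star (s ⟨j, i⟩) * P ⟨j, i⟩ ⟨l, i'⟩ *
      s ⟨l, i'⟩ - if (⟨j, i⟩ : Σ j, Fin (m j)) = ⟨l, i'⟩ then P ⟨j, i⟩ ⟨l, i'⟩ else 0) *
      w l i'‖ ≤ C * t := by
    have hsum (j) : ∑ i, ‖w j i‖ ≤ ∑ j, ∑ i, ‖w j i‖ :=
      Finset.single_le_sum (f := fun j ↦ ∑ i, ‖w j i‖)
        (fun j _ ↦ Finset.sum_nonneg fun i _ ↦ norm_nonneg _) (Finset.mem_univ j)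
    calc _ ≤ ∑ i, ∑ i', ‖w j i‖ * t * ‖w l i'‖ := by
          refine norm_sum_le_of_le _ fun i _ ↦ norm_sum_le_of_le _ fun i' _ ↦ ?_
          refine (norm_mul_le _ _).trans ?_
          gcongr
          refine (norm_mul_le _ _).trans ?_
          rw [norm_star]
          gcongr
          exact hs _ _
      _ = (∑ i, ‖w j i‖) * (∑ i', ‖w l i'‖) * t := by
          rw [Finset.sum_mul_sum, Finset.sum_mul]
          refine Finset.sum_congr rfl fun i _ ↦ ?_
          rw [Finset.sum_mul]
          exact Finset.sum_congr rfl fun i' _ ↦ by ring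
      _ ≤ C * t := by
          rw [hC, sq]
          gcongr
          · exact hsum j
          · exact hsum l
  refine ⟨fun j ↦ ∑ i, y j i * s ⟨j, i⟩ * w j i, fun j ↦ ?_, fun j l hjl ↦ ?_⟩
  · have hsplit : star (∑ i, y j i * s ⟨j, i⟩ * w j i) * M j j * (∑ i, y j i * s ⟨j, i⟩ * w j i)
        - M j j = (∑ i, ∑ i', star (w j i) * (star (s ⟨j, i⟩) * P ⟨j, i⟩ ⟨j, i'⟩ *
      s ⟨j, i'⟩ - if (⟨j, i⟩ : Σ j, Fin (m j)) = ⟨j, i'⟩ then P ⟨j, i⟩ ⟨j, i'⟩ else 0) *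
      w j i') + (∑ i, star (w j i) * (star (y j i) * a j * y j i) * w j i - a j) := by
      -- The subtracted diagonal of the block `j` of `P` reassembles to the approximation of `a j`.
      simp only [mul_sub, sub_mul, Finset.sum_sub_distrib, hMa]
      have h1 : ∑ i, ∑ i', star (w j i) * (if (⟨j, i⟩ : Σ j, Fin (m j)) = ⟨j, i'⟩ then
          P ⟨j, i⟩ ⟨j, i'⟩ else 0) * w j i' =
          ∑ i, star (w j i) * (star (y j i) * a j * y j i) * w j i := by
        refine Finset.sum_congr rfl fun i _ ↦ ?_
        rw [Finset.sum_eq_single i]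
        · simp [hP, hMa, CStarMatrix.ofMatrix_entry]
        · intro b _ hb
          simp [hb.symm]
        · simp
      have h2 : star (∑ i, y j i * s ⟨j, i⟩ * w j i) * a j * (∑ i, y j i * s ⟨j, i⟩ * w j i) =
          ∑ i, ∑ i', star (w j i) * (star (s ⟨j, i⟩) * P ⟨j, i⟩ ⟨j, i'⟩ * s ⟨j, i'⟩) * w j i' := by
        simp only [star_sum, Finset.sum_mul, Finset.mul_sum]
        rw [Finset.sum_comm]
        simp only [star_mul, hP,
          CStarMatrix.ofMatrix_entry, hMa, mul_assoc]
      rw [h1, h2]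
      abel
    rw [hsplit]
    refine (norm_add_le _ _).trans_lt ?_
    linarith [hbound j j, htε j, hw j]
  · refine lt_of_le_of_lt (le_of_eq_of_le (congrArg _ ?_) (hbound j l)) htτ
    simp only [star_sum, Finset.sum_mul, Finset.mul_sum]
    rw [Finset.sum_comm]
    simp only [star_mul, hP, CStarMatrix.ofMatrix_entry, mul_assoc, Sigma.mk.injEq, hjl,
      false_and, if_false, sub_zero]

/-- The Gram matrix of `(a, b)` has diagonal `a²`, `b²` and upper corner `a b`. -/
theorem HasMatrixDiagonalization.isStronglyPurelyInfinite
    (h : ∀ a b : A, 0 ≤ a → 0 ≤ b → HasMatrixDiagonalization ![a, b]) :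
    IsStronglyPurelyInfinite A := by
  intro a b ha hb ε hε
  have has : star a = a := (IsSelfAdjoint.of_nonneg ha).star_eq
  have hbs : star b = b := (IsSelfAdjoint.of_nonneg hb).star_eq
  have haa : 0 ≤ a * a := by simpa [has] using star_mul_self_nonneg a
  have hbb : 0 ≤ b * b := by simpa [hbs] using star_mul_self_nonneg b
  obtain ⟨s, hs, hs'⟩ := h _ _ haa hbb _ (CStarMatrix.nonneg_ofMatrix_star_mul ![a, b])
    (by simp [Fin.forall_fin_two, CStarMatrix.ofMatrix_entry, has, hbs]) (fun _ ↦ ε) ε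
    (fun _ ↦ hε) hε
  refine ⟨s 0, s 1, ?_, ?_, ?_⟩
  · simpa [has, CStarMatrix.ofMatrix_entry] using hs 0
  · simpa [hbs, CStarMatrix.ofMatrix_entry] using hs 1
  · simpa [has, CStarMatrix.ofMatrix_entry] using hs' 0 1 (by decide)

end CStar

theorem theorem1p1 {A : Type*} [NonUnitalCStarAlgebra A] [PartialOrder A] [StarOrderedRing A]
    (F : Set A) (hfill : IsFillingFamily F) (hdiag : HasMatrixDiagonalizationFamily F) :
    IsStronglyPurelyInfinite A ∧
      ∀ a b : A, 0 ≤ a → 0 ≤ b → HasMatrixDiagonalization ![a, b] := by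
  have h (a b : A) (ha : 0 ≤ a) (hb : 0 ≤ b) : HasMatrixDiagonalization ![a, b] :=
    hfill.hasMatrixDiagonalization hdiag (by simp [Fin.forall_fin_two, ha, hb])
  exact ⟨HasMatrixDiagonalization.isStronglyPurelyInfinite h, h⟩
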